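/- All distributive lattices are bounded. Let $\Gamma=\{r^-\mid r\in(0,1]\}\cup\{q^\circ\mid q\in\mathbb Q\cap[0,1]\}$, totally ordered by value, with $q^-<q^\circ$ for rational $q\in(0,1]$, and with the topology generated by the sets ${\uparrow}p^\circ$ ($p\in\mathbb Q\cap[0,1]$) and ${\downarrow}q^-$ ($q\in\mathbb Q\cap(0,1]$). For $y\le x$ in $\Gamma$ put $r^\circ-s^\circ=(r-s)^\circ$, $r^--s^\circ=(r-s)^-$, let $r^\circ-s^-$ and $r^--s^-$ both be $(r-s)^\circ$ if $r-s\in\mathbb Q$ and $(r-s)^-$ otherwise, and put $x\sim y=\bigvee\{x-q^\circ\mid y<q^\circ\le x\}$. For a distributive lattice $D$, let $\mathcal M(D)\subseteq\Gamma^D$ be the set of $\Gamma$-valued measures, that is, of monotone $\mu\colon D\to\Gamma$ with $\mu(0)=0^\circ$, $\mu(1)=1^\circ$ and, for all $a,b\in D$, $$\mu(a)\sim\mu(a\wedge b)\le\mu(a\vee b)-\mu(b),\qquad \mu(a)-\mu(a\wedge b)\ge\mu(a\vee b)\sim\mu(b),$$ with the order and the topology induced by $\Gamma^D$. Let $P(D)$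 be the quotient of the free distributive lattice on the symbols $P_{\ge p}a$ ($a\in D$, $p\in\mathbb Q\cap[0,1]$) by the lattice congruence generated by the following laws, for all $p,q,r\in\mathbb Q\cap[0,1]$ and $a,b\in D$ ($\varphi\models\psi$ stands for $\varphi\le\psi$, $\varphi\models$ for $\varphi\le 0$, and $\models\psi$ for $1\le\psi$): (L1) $P_{\ge q}a\models P_{\ge p}a$ whenever $p\le q$; (L2) $P_{\ge p}0\models$ whenever $p>0$, $\models P_{\ge 0}0$ and $\models P_{\ge q}1$; (L3) $P_{\ge q}a\models P_{\ge q}b$ whenever $a\le b$; (L4) $P_{\ge p}a\wedge P_{\ge q}b\models P_{\ge p+q-r}(a\vee b)\vee P_{\ge r}(a\wedge b)$ whenever $0\le p+q-r$, where for $p+q-r>1$ the symbol $P_{\ge p+q-r}(a\vee b)$ is read as $0$ (false); (L5) $P_{\ge p+q-r}(a\vee b)\wedge P_{\ge r}(a\wedge b)\models P_{\ge p}a\vee P_{\ge q}b$ whenever $0\le p+q-r\le 1$. **Theorem.** For every distributive lattice $D$, $\mathcal M(D)$ is a Priestley space, and $P(D)$ is isomorphic to its dual lattice, the lattice of clopen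 up-sets of $\mathcal M(D)$, by an isomorphism $e$ with $e(P_{\ge p}a)=\{\mu\mid\mu(a)\ge p^\circ\}$ for all $p$ and $a$. The $\Gamma$-valued measures are exactly the types of this logic: there is an isomorphism of ordered topological spaces $\theta$ from the space of prime filters of $P(D)$ (ordered by inclusion, with the topology generated by the sets $\{F\mid\varphi\in F\}$ and their complements) onto $\mathcal M(D)$ such that $\varphi\in F\iff\theta(F)\in e(\varphi)$ for all $F$ and all $\varphi\in P(D)$. Moreover, if the symbols $P_{<q}a$ ($a\in D$, $q\in\mathbb Q\cap[0,1]$) are added to the generators and the laws (L6) $P_{<q}a\wedge P_{\ge q}a\models$ and $\models P_{<q}a\vee P_{\ge q}a$ are added to (L1)–(L5), then the resulting quotient is isomorphic to the Boolean algebra of all clopen subsets of $\mathcal M(D)$, by an isomorphism that sends $P_{\ge p}a$ to $\{\mu\mid\mu(a)\ge p^\circ\}$ and $P_{<p}a$ to $\{\mu\mid\mu(a)<p^\circ\}$. -/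

import Mathlib

namespace ProbLogic

/-! ### The chain `Γ` -/

/-- The set `Γ = {r⁻ | r ∈ (0,1]} ∪ {q° | q ∈ ℚ ∩ [0,1]}`. -/
inductive Gam : Type
  | minus (r : Set.Ioc (0 : ℝ) 1) : Gam
  | circ (q : Set.Icc (0 : ℚ) 1) : Gam

namespace Gam

/-- The collapse `γ : Γ → [0,1]`, `r⁻, r° ↦ r` (as a real number). -/
def val : Gam → ℝ
  | minus r => (r : ℝ)
  | circ q => ((q : ℚ) : ℝ)

/-- Position of an element in the lexicographic product of `ℝ` and `{⁻ < °}`. -/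
def key : Gam → ℝ ×ₗ Bool
  | minus r => toLex ((r : ℝ), false)
  | circ q => toLex (((q : ℚ) : ℝ), true)

theorem key_injective : Function.Injective key := by
  rintro (⟨r, hr⟩ | ⟨q, hq⟩) (⟨r', hr'⟩ | ⟨q', hq'⟩) h <;> simp_all [key]

/-- The total order of `Γ`: by value, and `q⁻ < q°` for rational `q ∈ (0,1]`. -/
noncomputable instance : LinearOrder Gam := LinearOrder.lift' key key_injective

theorem le_iff_key {x y : Gam} : x ≤ y ↔ key x ≤ key y := Iff.rfl

theorem circ_le_circ {p q : Set.Icc (0 : ℚ) 1} : circ p ≤ circ q ↔ (p : ℚ) ≤ q := by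
  rw [le_iff_key, key, key, Prod.Lex.toLex_le_toLex, le_iff_lt_or_eq (a := (p : ℚ))]
  simp

theorem circ_le_minus {q : Set.Icc (0 : ℚ) 1} {r : Set.Ioc (0 : ℝ) 1} :
    circ q ≤ minus r ↔ ((q : ℚ) : ℝ) < r := by
  rw [le_iff_key, key, key, Prod.Lex.toLex_le_toLex]
  simp

theorem minus_le_circ {q : Set.Icc (0 : ℚ) 1} {r : Set.Ioc (0 : ℝ) 1} :
    minus r ≤ circ q ↔ (r : ℝ) ≤ ((q : ℚ) : ℝ) := by
  rw [le_iff_key, key, key, Prod.Lex.toLex_le_toLex, le_iff_lt_or_eq (a := (r : ℝ))]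
  simp

theorem minus_le_minus {r s : Set.Ioc (0 : ℝ) 1} : minus r ≤ minus s ↔ (r : ℝ) ≤ s := by
  rw [le_iff_key, key, key, Prod.Lex.toLex_le_toLex, le_iff_lt_or_eq (a := (r : ℝ))]
  simp

theorem val_mono {x y : Gam} (h : x ≤ y) : val x ≤ val y := by
  rcases x with r | q <;> rcases y with s | p
  · exact minus_le_minus.1 h
  · exact minus_le_circ.1 h
  · exact (circ_le_minus.1 h).le
  · simpa [val] using circ_le_circ.1 h

theorem val_nonneg (x : Gam) : 0 ≤ val x := by
  rcases x with ⟨r, hr⟩ | ⟨q, hq⟩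
  · exact hr.1.le
  · simpa [val] using hq.1

theorem val_le_one (x : Gam) : val x ≤ 1 := by
  rcases x with ⟨r, hr⟩ | ⟨q, hq⟩
  · exact hr.2
  · simp only [val]; exact_mod_cast hq.2

/-- The topology of `Γ`, generated by the sets `↑p°` (`p ∈ ℚ ∩ [0,1]`) and `↓q⁻`
(`q ∈ ℚ ∩ (0,1]`). -/
instance : TopologicalSpace Gam :=
  TopologicalSpace.generateFrom
    ({s | ∃ p : Set.Icc (0 : ℚ) 1, s = Set.Ici (circ p)} ∪
      {s | ∃ q : Set.Ioc (0 : ℝ) 1, (∃ t : ℚ, (t : ℝ) = q) ∧ s = Set.Iic (minus q)})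

/-- `Γ` has all joins. -/
theorem exists_isLUB (S : Set Gam) : ∃ x, IsLUB S x := by
  classical
  have hbdd : BddAbove (val '' S) := ⟨1, by rintro _ ⟨x, -, rfl⟩; exact val_le_one x⟩
  rcases S.eq_empty_or_nonempty with rfl | hne
  · refine ⟨circ ⟨0, by simp⟩, by simp, fun y _ => ?_⟩
    rcases y with ⟨r, hr⟩ | ⟨q, hq⟩
    · rw [circ_le_minus]; simpa using hr.1
    · rw [circ_le_circ]; exact hq.1
  have hle : ∀ x ∈ S, val x ≤ sSup (val '' S) := fun x hx => le_csSup hbdd ⟨x, hx, rfl⟩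
  have hlub : ∀ y ∈ upperBounds S, sSup (val '' S) ≤ val y := fun y hy =>
    csSup_le (hne.image _) (by rintro _ ⟨x, hx, rfl⟩; exact val_mono (hy hx))
  set r := sSup (val '' S) with hr
  by_cases hc : ∃ q, circ q ∈ S ∧ ((q : ℚ) : ℝ) = r
  · obtain ⟨q, hq, hqr⟩ := hc
    refine ⟨circ q, fun x hx => ?_, fun y hy => hy hq⟩
    have := hle x hx
    rcases x with s | s
    · rw [minus_le_circ, hqr]; exact this
    · rw [circ_le_circ]; rw [← hqr] at this; simpa [val] using this
  · have h1 : r ≤ 1 := csSup_le (hne.image _) (by rintro _ ⟨x, -, rfl⟩; exact val_le_one x)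
    have h0 : 0 < r := by
      obtain ⟨x, hx⟩ := hne
      rcases x with s | s
      · exact lt_of_lt_of_le s.2.1 (hle _ hx)
      · refine lt_of_le_of_lt (val_nonneg (circ s)) (lt_of_le_of_ne (hle _ hx) fun h => hc ⟨s, hx, h⟩)
    refine ⟨minus ⟨r, h0, h1⟩, fun x hx => ?_, fun y hy => ?_⟩
    · have := hle x hx
      rcases x with s | s
      · rw [minus_le_minus]; exact this
      · rw [circ_le_minus]; exact lt_of_le_of_ne this fun h => hc ⟨s, hx, h⟩
    · have := hlub y hy
      rcases y with s | s
      · rw [minus_le_minus]; exact this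
      · rw [minus_le_circ]; exact this

/-- The join `⋁ S` of a set of elements of `Γ`. -/
noncomputable def join (S : Set Gam) : Gam := (exists_isLUB S).choose

theorem isLUB_join (S : Set Gam) : IsLUB S (join S) := (exists_isLUB S).choose_spec

open Classical in
/-- The section `ι : [0,1] → Γ` of `γ`: `r ↦ r°` if `r` is rational and `r ↦ r⁻` otherwise. -/
noncomputable def incl (r : ℝ) (h0 : 0 ≤ r) (h1 : r ≤ 1) : Gam :=
  if h : ∃ q : ℚ, (q : ℝ) = r then
    circ ⟨h.choose, by
      have hq := h.choose_spec
      constructor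
      · have : (0 : ℝ) ≤ (h.choose : ℝ) := by rw [hq]; exact h0
        exact_mod_cast this
      · have : (h.choose : ℝ) ≤ 1 := by rw [hq]; exact h1
        exact_mod_cast this⟩
  else minus ⟨r, lt_of_le_of_ne h0 fun h' => h ⟨0, by simpa using h'⟩, h1⟩

/-- The partial operation `x − y` on `Γ`, defined for `y ≤ x`: `r° − s° = (r-s)°`,
`r⁻ − s° = (r-s)⁻`, and `r° − s⁻`, `r⁻ − s⁻` are `(r-s)°` if `r - s` is rational and `(r-s)⁻`
otherwise. -/
noncomputable def mip : (x y : Gam) → y ≤ x → Gam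
  | circ r, circ s, h => circ ⟨r - s, sub_nonneg.2 (circ_le_circ.1 h),
      (sub_le_self _ s.2.1).trans r.2.2⟩
  | minus r, circ s, h => minus ⟨r - ((s : ℚ) : ℝ), sub_pos.2 (circ_le_minus.1 h),
      (sub_le_self _ (val_nonneg (circ s))).trans r.2.2⟩
  | circ r, minus s, h => incl (((r : ℚ) : ℝ) - s) (sub_nonneg.2 (val_mono h))
      ((sub_le_self _ s.2.1.le).trans (val_le_one (circ r)))
  | minus r, minus s, h => incl ((r : ℝ) - s) (sub_nonneg.2 (val_mono h))
      ((sub_le_self _ s.2.1.le).trans r.2.2)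

/-- The partial operation `x ∼ y = ⋁ {x − q° | y < q° ≤ x}` on `Γ`, defined for `y ≤ x`. -/
noncomputable def miss (x y : Gam) (_h : y ≤ x) : Gam :=
  join {z | ∃ (q : Set.Icc (0 : ℚ) 1) (hq : circ q ≤ x), y < circ q ∧ z = mip x (circ q) hq}

end Gam

/-! ### `Γ`-valued measures -/

section Measures

variable (D : Type*) [DistribLattice D] [BoundedOrder D]

/-- A (finitely additive, probability) `Γ`-valued measure on a bounded distributive lattice. -/
structure IsMeasure {D : Type*} [DistribLattice D] [BoundedOrder D] (μ : D → Gam) : Prop where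
  map_bot : μ ⊥ = Gam.circ ⟨0, by simp⟩
  map_top : μ ⊤ = Gam.circ ⟨1, by simp⟩
  mono : Monotone μ
  miss_le_mip : ∀ a b : D, Gam.miss (μ a) (μ (a ⊓ b)) (mono inf_le_left) ≤
    Gam.mip (μ (a ⊔ b)) (μ b) (mono le_sup_right)
  miss_le_mip' : ∀ a b : D, Gam.miss (μ (a ⊔ b)) (μ b) (mono le_sup_right) ≤
    Gam.mip (μ a) (μ (a ⊓ b)) (mono inf_le_left)

/-- The set of `Γ`-valued measures on `D`. -/
def Mea : Type _ := {μ : D → Gam // IsMeasure μ}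

variable {D} in
/-- The value `μ(a)`. -/
def Mea.app (μ : Mea D) (a : D) : Gam := μ.1 a

/-- The order of `Mea D`, induced by the pointwise order of `D → Γ`. -/
noncomputable instance : PartialOrder (Mea D) :=
  inferInstanceAs (PartialOrder {μ : D → Gam // IsMeasure μ})

/-- The topology of `Mea D`, induced by the product topology of `D → Γ`. -/
instance : TopologicalSpace (Mea D) :=
  inferInstanceAs (TopologicalSpace {μ : D → Gam // IsMeasure μ})

end Measures

/-! ### Free (bounded) distributive lattices, and quotients by congruences -/

/-- Terms in the signature of bounded lattices with variables in `V`. -/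
inductive LTerm (V : Type*) : Type _
  | var (v : V) : LTerm V
  | bot : LTerm V
  | top : LTerm V
  | inf (s t : LTerm V) : LTerm V
  | sup (s t : LTerm V) : LTerm V

/-- Provable equality of terms from the equations of bounded distributive lattices. -/
inductive LTerm.Eqv {V : Type*} : LTerm V → LTerm V → Prop
  | refl (s) : Eqv s s
  | symm {s t} : Eqv s t → Eqv t s
  | trans {s t u} : Eqv s t → Eqv t u → Eqv s u
  | inf_congr {s s' t t'} : Eqv s s' → Eqv t t' → Eqv (.inf s t) (.inf s' t')
  | sup_congr {s s' t t'} : Eqv s s' → Eqv t t' → Eqv (.sup s t) (.sup s' t')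
  | inf_comm (s t) : Eqv (.inf s t) (.inf t s)
  | sup_comm (s t) : Eqv (.sup s t) (.sup t s)
  | inf_assoc (s t u) : Eqv (.inf (.inf s t) u) (.inf s (.inf t u))
  | sup_assoc (s t u) : Eqv (.sup (.sup s t) u) (.sup s (.sup t u))
  | inf_sup_self (s t) : Eqv (.inf s (.sup s t)) s
  | sup_inf_self (s t) : Eqv (.sup s (.inf s t)) s
  | sup_inf_left (s t u) : Eqv (.sup s (.inf t u)) (.inf (.sup s t) (.sup s u))
  | bot_sup (s) : Eqv (.sup .bot s) s
  | top_inf (s) : Eqv (.inf .top s) s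

/-- Provable equality as a setoid. -/
def LTerm.setoid (V : Type*) : Setoid (LTerm V) where
  r := LTerm.Eqv
  iseqv := ⟨.refl, .symm, .trans⟩

/-- The free (bounded) distributive lattice on the set `V`. -/
def FreeDL (V : Type*) : Type _ := Quotient (LTerm.setoid V)

namespace FreeDL

variable {V : Type*}

/-- The class of a term. -/
def mk (t : LTerm V) : FreeDL V := Quotient.mk (LTerm.setoid V) t

/-- The free generator belonging to `v`. -/
def of (v : V) : FreeDL V := mk (.var v)

instance : Max (FreeDL V) :=
  ⟨Quotient.map₂ LTerm.sup fun _ _ h _ _ h' => LTerm.Eqv.sup_congr h h'⟩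

instance : Min (FreeDL V) :=
  ⟨Quotient.map₂ LTerm.inf fun _ _ h _ _ h' => LTerm.Eqv.inf_congr h h'⟩

instance : Lattice (FreeDL V) :=
  Lattice.mk'
    (by rintro ⟨a⟩ ⟨b⟩; exact Quotient.sound (LTerm.Eqv.sup_comm a b))
    (by rintro ⟨a⟩ ⟨b⟩ ⟨c⟩; exact Quotient.sound (LTerm.Eqv.sup_assoc a b c))
    (by rintro ⟨a⟩ ⟨b⟩; exact Quotient.sound (LTerm.Eqv.inf_comm a b))
    (by rintro ⟨a⟩ ⟨b⟩ ⟨c⟩; exact Quotient.sound (LTerm.Eqv.inf_assoc a b c))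
    (by rintro ⟨a⟩ ⟨b⟩; exact Quotient.sound (LTerm.Eqv.sup_inf_self a b))
    (by rintro ⟨a⟩ ⟨b⟩; exact Quotient.sound (LTerm.Eqv.inf_sup_self a b))

instance : DistribLattice (FreeDL V) where
  le_sup_inf := by
    rintro ⟨a⟩ ⟨b⟩ ⟨c⟩
    exact le_of_eq (Quotient.sound (LTerm.Eqv.sup_inf_left a b c)).symm

instance : BoundedOrder (FreeDL V) where
  top := mk .top
  bot := mk .bot
  le_top := by
    rintro ⟨a⟩
    exact inf_eq_right.1 (Quotient.sound (LTerm.Eqv.top_inf a))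
  bot_le := by
    rintro ⟨a⟩
    exact sup_eq_right.1 (Quotient.sound (LTerm.Eqv.bot_sup a))

end FreeDL

section Quotients

variable {L : Type*} [DistribLattice L] [BoundedOrder L]

/-- The least lattice congruence on `L` in which `φ ⊓ ψ` is identified with `φ`, that is, in whose
quotient `φ ≤ ψ` holds, whenever `R φ ψ`. -/
def conGen (R : L → L → Prop) : LatticeCon L where
  r x y := ∀ c : LatticeCon L, (∀ φ ψ, R φ ψ → c.r (φ ⊓ ψ) φ) → c.r x y
  iseqv := ⟨fun x c _ => c.iseqv.refl x, fun h c hc => c.iseqv.symm (h c hc),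
    fun h h' c hc => c.iseqv.trans (h c hc) (h' c hc)⟩
  inf := fun h h' c hc => c.inf (h c hc) (h' c hc)
  sup := fun h h' c hc => c.sup (h c hc) (h' c hc)

/-- The quotient of the lattice `L` by a congruence. -/
def LatQuot (c : LatticeCon L) : Type _ := Quotient c.toSetoid

namespace LatQuot

variable (c : LatticeCon L)

/-- The quotient map. -/
def mk (x : L) : LatQuot c := Quotient.mk c.toSetoid x

instance : Max (LatQuot c) := ⟨Quotient.map₂ (· ⊔ ·) fun _ _ h _ _ h' => c.sup h h'⟩

instance : Min (LatQuot c) := ⟨Quotient.map₂ (· ⊓ ·) fun _ _ h _ _ h' => c.inf h h'⟩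

instance : Lattice (LatQuot c) :=
  Lattice.mk'
    (by rintro ⟨x⟩ ⟨y⟩; exact congrArg (mk c) (sup_comm x y))
    (by rintro ⟨x⟩ ⟨y⟩ ⟨z⟩; exact congrArg (mk c) (sup_assoc x y z))
    (by rintro ⟨x⟩ ⟨y⟩; exact congrArg (mk c) (inf_comm x y))
    (by rintro ⟨x⟩ ⟨y⟩ ⟨z⟩; exact congrArg (mk c) (inf_assoc x y z))
    (by rintro ⟨x⟩ ⟨y⟩; exact congrArg (mk c) (sup_inf_self (a := x) (b := y)))
    (by rintro ⟨x⟩ ⟨y⟩; exact congrArg (mk c) (inf_sup_self (a := x) (b := y)))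

instance : DistribLattice (LatQuot c) where
  le_sup_inf := by
    rintro ⟨x⟩ ⟨y⟩ ⟨z⟩
    exact le_of_eq (congrArg (mk c) (sup_inf_left x y z)).symm

instance : BoundedOrder (LatQuot c) where
  top := mk c ⊤
  bot := mk c ⊥
  le_top := by
    rintro ⟨x⟩
    exact inf_eq_right.1 (congrArg (mk c) (top_inf_eq x))
  bot_le := by
    rintro ⟨x⟩
    exact sup_eq_right.1 (congrArg (mk c) (bot_sup_eq x))

end LatQuot

end Quotients

/-! ### The logic of measures -/

/-- The laws (L1)--(L5), for a family `P p a` of elements of a lattice (to be read as `P_{≥p} a`).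
`Law P φ ψ` says that `φ ⊨ ψ` is an instance of one of the laws; `φ ⊨` is `φ ⊨ ⊥`, and `⊨ ψ` is
`⊤ ⊨ ψ`. In (L4) and (L5), `s` stands for `p + q - r`. The instances of (L4) with `p + q - r > 1`,
where `P_{≥p+q-r}(a ∨ b)` is read as `⊥`, are `L4_gt`. -/
inductive Law {D : Type*} [DistribLattice D] [BoundedOrder D]
    {L : Type*} [DistribLattice L] [BoundedOrder L]
    (P : Set.Icc (0 : ℚ) 1 → D → L) : L → L → Prop
  | L1 (p q : Set.Icc (0 : ℚ) 1) (a : D) : p ≤ q → Law P (P q a) (P p a)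
  | L2_false (p : Set.Icc (0 : ℚ) 1) : 0 < (p : ℚ) → Law P (P p ⊥) ⊥
  | L2_zero (p : Set.Icc (0 : ℚ) 1) : (p : ℚ) = 0 → Law P ⊤ (P p ⊥)
  | L2_true (q : Set.Icc (0 : ℚ) 1) : Law P ⊤ (P q ⊤)
  | L3 (q : Set.Icc (0 : ℚ) 1) (a b : D) : a ≤ b → Law P (P q a) (P q b)
  | L4 (p q r s : Set.Icc (0 : ℚ) 1) (a b : D) : (s : ℚ) = p + q - r →
      Law P (P p a ⊓ P q b) (P s (a ⊔ b) ⊔ P r (a ⊓ b))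
  | L4_gt (p q r : Set.Icc (0 : ℚ) 1) (a b : D) : 1 < (p : ℚ) + q - r →
      Law P (P p a ⊓ P q b) (P r (a ⊓ b))
  | L5 (p q r s : Set.Icc (0 : ℚ) 1) (a b : D) : (s : ℚ) = p + q - r →
      Law P (P s (a ⊔ b) ⊓ P r (a ⊓ b)) (P p a ⊔ P q b)

section Logic

variable (D : Type*) [DistribLattice D] [BoundedOrder D]

/-- The propositional variables `P_{≥p} a`. -/
inductive GeVar (D : Type*) : Type _
  | ge (p : Set.Icc (0 : ℚ) 1) (a : D) : GeVar D

/-- The congruence generated by (L1)--(L5) on the free distributive lattice on the symbols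
`P_{≥p} a`. -/
def pCon : LatticeCon (FreeDL (GeVar D)) :=
  conGen (Law fun p (a : D) => FreeDL.of (GeVar.ge p a))

/-- The lattice `P(D)`: the quotient of the free distributive lattice on the symbols `P_{≥p} a` by
the congruence generated by (L1)--(L5). -/
abbrev PLat : Type _ := LatQuot (pCon D)

variable {D} in
/-- The element `P_{≥p} a` of `P(D)`. -/
def PLat.ge (p : Set.Icc (0 : ℚ) 1) (a : D) : PLat D :=
  LatQuot.mk (pCon D) (FreeDL.of (GeVar.ge p a))

/-- The propositional variables `P_{≥p} a` and `P_{<p} a`. -/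
inductive GeLtVar (D : Type*) : Type _
  | ge (p : Set.Icc (0 : ℚ) 1) (a : D) : GeLtVar D
  | lt (p : Set.Icc (0 : ℚ) 1) (a : D) : GeLtVar D

/-- The laws (L1)--(L6) on the free distributive lattice on the symbols `P_{≥p} a`, `P_{<p} a`:
(L6) says that `P_{<p} a` is the negation of `P_{≥p} a`. -/
inductive Law6 {D : Type*} [DistribLattice D] [BoundedOrder D] :
    FreeDL (GeLtVar D) → FreeDL (GeLtVar D) → Prop
  | L1_to_L5 {φ ψ : FreeDL (GeLtVar D)} :
      Law (fun p (a : D) => FreeDL.of (GeLtVar.ge p a)) φ ψ → Law6 φ ψ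
  | L6_contra (q : Set.Icc (0 : ℚ) 1) (a : D) :
      Law6 (FreeDL.of (GeLtVar.lt q a) ⊓ FreeDL.of (GeLtVar.ge q a)) ⊥
  | L6_em (q : Set.Icc (0 : ℚ) 1) (a : D) :
      Law6 ⊤ (FreeDL.of (GeLtVar.lt q a) ⊔ FreeDL.of (GeLtVar.ge q a))

/-- The congruence generated by (L1)--(L6). -/
def bCon : LatticeCon (FreeDL (GeLtVar D)) := conGen (Law6 (D := D))

/-- The quotient of the free distributive lattice on the symbols `P_{≥p} a`, `P_{<p} a` by the
congruence generated by (L1)--(L6). -/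
abbrev BLat : Type _ := LatQuot (bCon D)

variable {D} in
/-- The element `P_{≥p} a` of the quotient by (L1)--(L6). -/
def BLat.ge (p : Set.Icc (0 : ℚ) 1) (a : D) : BLat D :=
  LatQuot.mk (bCon D) (FreeDL.of (GeLtVar.ge p a))

variable {D} in
/-- The element `P_{<p} a` of the quotient by (L1)--(L6). -/
def BLat.lt (p : Set.Icc (0 : ℚ) 1) (a : D) : BLat D :=
  LatQuot.mk (bCon D) (FreeDL.of (GeLtVar.lt p a))

end Logic

/-! ### The dual space of a distributive lattice -/

section Dual

variable (L : Type*) [DistribLattice L] [BoundedOrder L]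

/-- The set of prime filters of `L` (the types, when `L` is the Lindenbaum--Tarski algebra of a
logic). -/
def DualSpace : Type _ := {F : Order.PFilter L // F.IsPrime}

/-- Prime filters are ordered by inclusion. -/
instance : PartialOrder (DualSpace L) :=
  inferInstanceAs (PartialOrder {F : Order.PFilter L // F.IsPrime})

/-- The topology on prime filters generated by the sets `{F | a ∈ F}` and their complements. -/
instance : TopologicalSpace (DualSpace L) :=
  TopologicalSpace.generateFrom
    ({s | ∃ a : L, s = {F : DualSpace L | a ∈ F.1}} ∪
      {s | ∃ a : L, s = {F : DualSpace L | a ∉ F.1}})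

end Dual

end ProbLogic

/-!
An element of `Γ` is determined by the set of rationals `p` with `p° ≤ x`, and the sets that arise
are exactly the down-sets of `ℚ ∩ [0,1]` that contain `0` (`Gam.le_of_forall_circ`,
`Gam.circ_le_join_iff`). Read on these sets, `x - y` is adjoint to addition
(`Gam.circ_le_mip_iff`), and the two inequalities in the definition of a measure become the laws
(L4) and (L5) for the truth assignment `P_{≥p} a := p° ≤ μ(a)` (`Gam.miss_le_mip_iff`). The laws
allow arbitrary `r` where the inequalities give only `r ≤ p`, and the inequalities forbid sums
above `1` on which (L5) is silent; in both cases monotonicity in `a` closes the gap. So measures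
are the same thing as models of (L1)--(L5) in the two-element lattice `Prop` (`Mea.isModel`,
`IsModel.isMeasure`).

By the universal property of the presentation, such models are the homomorphisms `P(D) → Prop`,
and homomorphisms to `Prop` are the prime filters of `P(D)`. This gives the bijection
`Mea.dualHomeo`, under which the sets `{F | φ ∈ F}` correspond to the sets `{μ | μ ⊨ φ}`. Since the
sets `{μ | p° ≤ μ(a)}` and their complements generate the topology, the bijection is a
homeomorphism, and `Mea D` inherits compactness from the space of prime filters.

The map `φ ↦ {μ | μ ⊨ φ}` reflects the order by the prime filter theorem (`le_of_forall_hom`). It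
is onto the clopen up-sets by compactness, because elements of `P(D)` separate `μ` from `ν` whenever
`μ ≰ ν` (`exists_eq_of_separated`). With (L6) the homomorphisms to `Prop` are still the measures
(`Mea.exists_boolEval_eq`), while any two distinct points are now separated, so that all clopen sets
are reached.
-/

namespace ProbLogic

/-! ### Elements of `Γ` as down-sets of rationals -/

namespace Gam

theorem le_of_forall_circ {x y : Gam} (h : ∀ p, circ p ≤ x → circ p ≤ y) : x ≤ y := by
  rcases x with r | p
  · by_contra hlt
    obtain ⟨c, hc0, hcr, hc⟩ : ∃ c : ℚ, 0 ≤ c ∧ (c : ℝ) < r ∧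
        ∀ hc : c ∈ Set.Icc (0 : ℚ) 1, ¬ circ ⟨c, hc⟩ ≤ y := by
      rcases y with s | q
      · rw [minus_le_minus, not_le] at hlt
        obtain ⟨c, hsc, hcr⟩ := exists_rat_btwn hlt
        refine ⟨c, ?_, hcr, fun _ => ?_⟩
        · exact_mod_cast (s.2.1.trans hsc).le
        · rw [circ_le_minus, not_lt]; exact hsc.le
      · rw [minus_le_circ, not_le] at hlt
        obtain ⟨c, hsc, hcr⟩ := exists_rat_btwn hlt
        have hsc' : (q : ℚ) < c := by exact_mod_cast hsc
        refine ⟨c, q.2.1.trans hsc'.le, hcr, fun _ => ?_⟩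
        rw [circ_le_circ, not_le]; exact hsc'
    have hc1 : c ≤ 1 := by exact_mod_cast (hcr.trans_le r.2.2).le
    exact hc ⟨hc0, hc1⟩ (h _ (circ_le_minus.2 hcr))
  · exact h p le_rfl

theorem circ_zero_le (x : Gam) : circ ⟨0, by simp⟩ ≤ x := by
  rcases x with r | q
  · rw [circ_le_minus]; simpa using r.2.1
  · rw [circ_le_circ]; exact q.2.1

theorem circ_le_incl {p : Set.Icc (0 : ℚ) 1} {r : ℝ} (h0 : 0 ≤ r) (h1 : r ≤ 1) :
    circ p ≤ incl r h0 h1 ↔ ((p : ℚ) : ℝ) ≤ r := by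
  unfold incl
  split_ifs with h
  · rw [circ_le_circ, ← Rat.cast_le (K := ℝ), h.choose_spec]
  · rw [circ_le_minus, lt_iff_le_and_ne]
    exact and_iff_left fun h' => h ⟨_, h'⟩

/-- For rational `q > 0` the element `q⁻` is the predecessor of `q°` in `Γ`. -/
theorem le_minus_iff {x : Gam} {p : Set.Icc (0 : ℚ) 1} {r : Set.Ioc (0 : ℝ) 1}
    (h : (r : ℝ) = ((p : ℚ) : ℝ)) : x ≤ minus r ↔ ¬ circ p ≤ x := by
  rcases x with s | q
  · rw [minus_le_minus, circ_le_minus, h, not_lt]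
  · rw [circ_le_minus, circ_le_circ, h, not_le, Rat.cast_lt]

/-- Elements of `Γ` correspond to the sets of rationals in `[0,1]` that contain `0` and are closed
downwards. -/
theorem circ_le_join_iff {S : Set (Set.Icc (0 : ℚ) 1)} (hS : IsLowerSet S)
    (h0 : ⟨0, by simp⟩ ∈ S) {p : Set.Icc (0 : ℚ) 1} : circ p ≤ join (circ '' S) ↔ p ∈ S := by
  refine ⟨fun h => ?_, fun h => (isLUB_join _).1 ⟨p, h, rfl⟩⟩
  by_contra hp
  have hp0 : (0 : ℚ) < p := lt_of_le_of_ne p.2.1 fun h' => hp (by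
    convert h0; exact h'.symm)
  have hr : ((p : ℚ) : ℝ) ∈ Set.Ioc (0 : ℝ) 1 :=
    ⟨by exact_mod_cast hp0, by exact_mod_cast p.2.2⟩
  refine (le_minus_iff (r := ⟨_, hr⟩) (p := p) rfl).1 ((isLUB_join _).2 ?_) h
  rintro _ ⟨q, hq, rfl⟩
  rw [le_minus_iff rfl, circ_le_circ]
  exact fun hpq => hp (hS hpq hq)

/-- The difference is adjoint to addition: `p° ≤ x - y` says that `p + t` lies below `x` for every
rational `t` below `y`. -/
theorem circ_le_mip_iff {x y : Gam} (h : y ≤ x) {p : Set.Icc (0 : ℚ) 1} :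
    circ p ≤ mip x y h ↔
      ∀ t, circ t ≤ y → ∃ s : Set.Icc (0 : ℚ) 1, (s : ℚ) = p + t ∧ circ s ≤ x := by
  have hp := p.2.1
  rcases x with r | r <;> rcases y with w | w
  · simp only [mip, circ_le_incl, circ_le_minus]
    constructor
    · intro hle t ht
      have ht0 := t.2.1
      have hlt : ((p : ℚ) : ℝ) + ((t : ℚ) : ℝ) < r := by linarith
      have : (p : ℚ) + t ≤ 1 := by exact_mod_cast (hlt.trans_le r.2.2).le
      exact ⟨⟨p + t, by positivity, this⟩, rfl, by push_cast; exact hlt⟩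
    · intro H
      by_contra! hlt
      obtain ⟨s, hs, hsr⟩ := H ⟨0, by simp⟩ (by simpa using w.2.1)
      simp only [add_zero] at hs
      rw [hs] at hsr
      obtain ⟨t, htr, htw⟩ := exists_rat_btwn (show (r : ℝ) - ((p : ℚ) : ℝ) < w by linarith)
      have ht0 : 0 ≤ t := by
        have : (0 : ℝ) ≤ t := by linarith
        exact_mod_cast this
      have ht1 : t ≤ 1 := by exact_mod_cast (htw.trans_le w.2.2).le
      obtain ⟨s, hs, hsr⟩ := H ⟨t, ht0, ht1⟩ htw
      rw [hs] at hsr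
      push_cast at hsr
      linarith
  · simp only [mip, circ_le_minus, circ_le_circ]
    constructor
    · intro hle t ht
      have ht0 := t.2.1
      have htw : ((t : ℚ) : ℝ) ≤ ((w : ℚ) : ℝ) := by exact_mod_cast ht
      have hlt : ((p : ℚ) : ℝ) + ((t : ℚ) : ℝ) < r := by linarith
      have : (p : ℚ) + t ≤ 1 := by exact_mod_cast (hlt.trans_le r.2.2).le
      exact ⟨⟨p + t, by positivity, this⟩, rfl, by push_cast; exact hlt⟩
    · intro H
      obtain ⟨s, hs, hsr⟩ := H w le_rfl
      rw [hs] at hsr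
      push_cast at hsr
      linarith
  · simp only [mip, circ_le_incl, circ_le_minus, circ_le_circ]
    constructor
    · intro hle t ht
      have ht0 := t.2.1
      have hlt : ((p : ℚ) : ℝ) + ((t : ℚ) : ℝ) ≤ ((r : ℚ) : ℝ) := by linarith
      have hlt' : (p : ℚ) + t ≤ r := by exact_mod_cast hlt
      exact ⟨⟨p + t, by positivity, hlt'.trans r.2.2⟩, rfl, hlt'⟩
    · intro H
      by_contra! hlt
      obtain ⟨s, hs, hsr⟩ := H ⟨0, by simp⟩ (by simpa using w.2.1)
      simp only [add_zero] at hs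
      rw [hs] at hsr
      have hpr : ((p : ℚ) : ℝ) ≤ ((r : ℚ) : ℝ) := by exact_mod_cast hsr
      obtain ⟨t, htr, htw⟩ :=
        exists_rat_btwn (show ((r : ℚ) : ℝ) - ((p : ℚ) : ℝ) < w by linarith)
      have ht0 : 0 ≤ t := by
        have : (0 : ℝ) ≤ t := by linarith
        exact_mod_cast this
      have ht1 : t ≤ 1 := by exact_mod_cast (htw.trans_le w.2.2).le
      obtain ⟨s, hs, hsr⟩ := H ⟨t, ht0, ht1⟩ htw
      rw [hs] at hsr
      have hsr' : ((p : ℚ) : ℝ) + (t : ℝ) ≤ ((r : ℚ) : ℝ) := by exact_mod_cast hsr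
      linarith
  · simp only [mip, circ_le_circ]
    constructor
    · intro hle t ht
      have ht0 := t.2.1
      have hlt : (p : ℚ) + t ≤ r := by linarith
      exact ⟨⟨p + t, by positivity, hlt.trans r.2.2⟩, rfl, hlt⟩
    · intro H
      obtain ⟨s, hs, hsr⟩ := H w le_rfl
      linarith

/-- The inequalities in the definition of a measure, read on the down-sets of rationals that
represent the elements of `Γ`. -/
theorem miss_le_mip_iff {x y u v : Gam} (h : y ≤ x) (h' : v ≤ u) :
    miss x y h ≤ mip u v h' ↔ ∀ p q t : Set.Icc (0 : ℚ) 1, circ p ≤ x → q ≤ p → ¬ circ q ≤ y →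
      circ t ≤ v → ∃ s : Set.Icc (0 : ℚ) 1, (s : ℚ) = p - q + t ∧ circ s ≤ u := by
  rw [miss, isLUB_le_iff (isLUB_join _)]
  constructor
  · intro H p q t hp hqp hq ht
    have hqx : circ q ≤ x := (circ_le_circ.2 hqp).trans hp
    have hqp' : (q : ℚ) ≤ p := hqp
    have hq0 := q.2.1
    have hp1 := p.2.2
    have hle := H ⟨q, hqx, not_le.1 hq, rfl⟩
    have hc : circ ⟨p - q, sub_nonneg.2 hqp', by linarith⟩ ≤ mip x (circ q) hqx := by
      rw [circ_le_mip_iff]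
      intro t' ht'
      have ht'q : (t' : ℚ) ≤ q := circ_le_circ.1 ht'
      have ht0 := t'.2.1
      exact ⟨⟨p - q + t', by linarith, by linarith⟩, rfl,
        (circ_le_circ.2 (by simp only; linarith)).trans hp⟩
    exact (circ_le_mip_iff h').1 (hc.trans hle) t ht
  · rintro H _ ⟨q, hqx, hyq, rfl⟩
    refine le_of_forall_circ fun c hc => (circ_le_mip_iff h').2 fun t ht => ?_
    obtain ⟨s, hs, hsx⟩ := (circ_le_mip_iff hqx).1 hc q le_rfl
    have hc0 := c.2.1
    obtain ⟨s', hs', hsu⟩ := H s q t hsx (show (q : ℚ) ≤ s by linarith) (not_le.2 hyq) ht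
    exact ⟨s', by rw [hs', hs]; ring, hsu⟩

theorem isOpen_Ici_circ (p : Set.Icc (0 : ℚ) 1) : IsOpen (Set.Ici (circ p)) :=
  TopologicalSpace.isOpen_generateFrom_of_mem (Or.inl ⟨p, rfl⟩)

theorem isClopen_Ici_circ (p : Set.Icc (0 : ℚ) 1) : IsClopen (Set.Ici (circ p)) := by
  refine ⟨?_, isOpen_Ici_circ p⟩
  rcases p.2.1.eq_or_lt with h0 | h0
  · have hp : p = ⟨0, by simp⟩ := Subtype.ext h0.symm
    have : Set.Ici (circ p) = Set.univ :=
      Set.eq_univ_of_forall fun x => by rw [hp]; exact circ_zero_le x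
    rw [this]; exact isClosed_univ
  · have hr : ((p : ℚ) : ℝ) ∈ Set.Ioc (0 : ℝ) 1 :=
      ⟨by exact_mod_cast h0, by exact_mod_cast p.2.2⟩
    have : (Set.Ici (circ p))ᶜ = Set.Iic (minus ⟨_, hr⟩) := by
      ext x; exact (le_minus_iff rfl).symm
    rw [← isOpen_compl_iff, this]
    exact TopologicalSpace.isOpen_generateFrom_of_mem (Or.inr ⟨_, ⟨p, rfl⟩, rfl⟩)

/-- A map into `Γ` is continuous as soon as the preimages of the sets `↑p°` are clopen. -/
theorem continuous_of_isClopen {X : Type*} [TopologicalSpace X] {f : X → Gam}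
    (h : ∀ p, IsClopen {x | circ p ≤ f x}) : Continuous f := by
  refine continuous_generateFrom_iff.2 ?_
  rintro s (⟨p, rfl⟩ | ⟨⟨r, hr⟩, ⟨t, ht⟩, rfl⟩)
  · exact (h p).2
  · simp only at ht
    subst ht
    have ht : t ∈ Set.Icc (0 : ℚ) 1 := ⟨by exact_mod_cast hr.1.le, by exact_mod_cast hr.2⟩
    have : f ⁻¹' Set.Iic (minus ⟨t, hr⟩) = {x | circ ⟨t, ht⟩ ≤ f x}ᶜ := by
      ext x; exact le_minus_iff rfl
    rw [this]
    exact (h _).compl.2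

end Gam

/-! ### Homomorphisms out of presented lattices -/

theorem LatQuot.mk_le_mk {L : Type*} [DistribLattice L] {R : L → L → Prop} {φ ψ : L}
    (h : R φ ψ) :
    LatQuot.mk (conGen R) φ ≤ LatQuot.mk (conGen R) ψ :=
  inf_eq_left.1 (Quotient.sound fun _ hc => hc φ ψ h)

section Presentation

variable {V L M : Type*} [DistribLattice L] [BoundedOrder L] [DistribLattice M] [BoundedOrder M]

/-- The value of a lattice term under an assignment of its variables. -/
def LTerm.eval (v : V → M) : LTerm V → M
  | var x => v x
  | bot => ⊥
  | top => ⊤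
  | inf s t => s.eval v ⊓ t.eval v
  | sup s t => s.eval v ⊔ t.eval v

theorem LTerm.Eqv.eval_eq (v : V → M) {s t : LTerm V} (h : LTerm.Eqv s t) :
    s.eval v = t.eval v := by
  induction h with
  | refl => rfl
  | symm _ ih => exact ih.symm
  | trans _ _ ih ih' => exact ih.trans ih'
  | inf_congr _ _ ih ih' => exact congrArg₂ (· ⊓ ·) ih ih'
  | sup_congr _ _ ih ih' => exact congrArg₂ (· ⊔ ·) ih ih'
  | inf_comm => exact _root_.inf_comm _ _
  | sup_comm => exact _root_.sup_comm _ _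
  | inf_assoc => exact _root_.inf_assoc _ _ _
  | sup_assoc => exact _root_.sup_assoc _ _ _
  | inf_sup_self => exact _root_.inf_sup_self
  | sup_inf_self => exact _root_.sup_inf_self
  | sup_inf_left => exact _root_.sup_inf_left _ _ _
  | bot_sup => exact bot_sup_eq _
  | top_inf => exact top_inf_eq _

/-- The homomorphism out of a free distributive lattice that extends a given assignment. -/
def FreeDL.lift (v : V → M) : BoundedLatticeHom (FreeDL V) M where
  toFun := Quotient.lift (LTerm.eval v) fun _ _ h => h.eval_eq v
  map_sup' := by rintro ⟨s⟩ ⟨t⟩; rfl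
  map_inf' := by rintro ⟨s⟩ ⟨t⟩; rfl
  map_top' := rfl
  map_bot' := rfl

/-- The kernel congruence of a homomorphism. -/
def kerCon (f : BoundedLatticeHom L M) : LatticeCon L where
  r x y := f x = f y
  iseqv := ⟨fun _ => rfl, Eq.symm, Eq.trans⟩
  inf h h' := by simp only [map_inf, h, h']
  sup h h' := by simp only [map_sup, h, h']

/-- The homomorphism `L → LatQuot c`. -/
def LatQuot.mkHom (c : LatticeCon L) : BoundedLatticeHom L (LatQuot c) where
  toFun := LatQuot.mk c
  map_sup' _ _ := rfl
  map_inf' _ _ := rfl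
  map_top' := rfl
  map_bot' := rfl

/-- A homomorphism that respects the relations in `R` factors through the quotient by `R`. -/
def LatQuot.lift {R : L → L → Prop} (f : BoundedLatticeHom L M)
    (h : ∀ φ ψ, R φ ψ → f φ ≤ f ψ) : BoundedLatticeHom (LatQuot (conGen R)) M where
  toFun := Quotient.lift f fun _ _ hxy =>
    hxy (kerCon f) fun φ ψ hR => by
      change f (φ ⊓ ψ) = f φ
      rw [map_inf]; exact inf_eq_left.2 (h φ ψ hR)
  map_sup' := by rintro ⟨s⟩ ⟨t⟩; exact map_sup f s t
  map_inf' := by rintro ⟨s⟩ ⟨t⟩; exact map_inf f s t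
  map_top' := map_top f
  map_bot' := map_bot f

theorem LatQuot.induction {c : LatticeCon (FreeDL V)} {motive : LatQuot c → Prop}
    (of : ∀ v, motive (LatQuot.mk c (FreeDL.of v))) (bot : motive ⊥) (top : motive ⊤)
    (inf : ∀ φ ψ, motive φ → motive ψ → motive (φ ⊓ ψ))
    (sup : ∀ φ ψ, motive φ → motive ψ → motive (φ ⊔ ψ)) (φ : LatQuot c) : motive φ := by
  obtain ⟨⟨t⟩⟩ := φ
  change motive (LatQuot.mk c (FreeDL.mk t))
  induction t with
  | var v => exact of v
  | bot => exact bot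
  | top => exact top
  | inf s t hs ht => exact inf _ _ hs ht
  | sup s t hs ht => exact sup _ _ hs ht

theorem LatQuot.hom_inf {c : LatticeCon L} (f : BoundedLatticeHom (LatQuot c) M)
    (φ ψ : LatQuot c) : f (φ ⊓ ψ) = f φ ⊓ f ψ := f.map_inf' φ ψ

theorem LatQuot.hom_sup {c : LatticeCon L} (f : BoundedLatticeHom (LatQuot c) M)
    (φ ψ : LatQuot c) : f (φ ⊔ ψ) = f φ ⊔ f ψ := f.map_sup' φ ψ

theorem LatQuot.hom_ext {c : LatticeCon (FreeDL V)} {f g : BoundedLatticeHom (LatQuot c) M}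
    (h : ∀ v, f (LatQuot.mk c (FreeDL.of v)) = g (LatQuot.mk c (FreeDL.of v))) : f = g := by
  ext φ
  induction φ using LatQuot.induction with
  | of v => exact h v
  | bot => rw [map_bot, map_bot]
  | top => rw [map_top, map_top]
  | inf φ ψ hφ hψ => rw [hom_inf, hom_inf, hφ, hψ]
  | sup φ ψ hφ hψ => rw [hom_sup, hom_sup, hφ, hψ]

variable {D : Type*} [DistribLattice D] [BoundedOrder D]

theorem Law.map {P : Set.Icc (0 : ℚ) 1 → D → L} (f : BoundedLatticeHom L M) {φ ψ : L}
    (h : Law P φ ψ) : Law (fun p a => f (P p a)) (f φ) (f ψ) := by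
  cases h with
  | L1 p q a h => exact .L1 p q a h
  | L2_false p h => rw [map_bot]; exact .L2_false p h
  | L2_zero p h => rw [map_top]; exact .L2_zero p h
  | L2_true q => rw [map_top]; exact .L2_true q
  | L3 q a b h => exact .L3 q a b h
  | L4 p q r s a b h => rw [map_inf, map_sup]; exact .L4 p q r s a b h
  | L4_gt p q r a b h => rw [map_inf]; exact .L4_gt p q r a b h
  | L5 p q r s a b h => rw [map_inf, map_sup]; exact .L5 p q r s a b h

theorem Law.exists_of_map {P : Set.Icc (0 : ℚ) 1 → D → L} (f : BoundedLatticeHom L M) {φ' ψ' : M}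
    (h : Law (fun p a => f (P p a)) φ' ψ') : ∃ φ ψ, Law P φ ψ ∧ f φ = φ' ∧ f ψ = ψ' := by
  cases h with
  | L1 p q a h => exact ⟨_, _, .L1 p q a h, rfl, rfl⟩
  | L2_false p h => exact ⟨_, _, .L2_false p h, rfl, map_bot f⟩
  | L2_zero p h => exact ⟨_, _, .L2_zero p h, map_top f, rfl⟩
  | L2_true q => exact ⟨_, _, .L2_true q, map_top f, rfl⟩
  | L3 q a b h => exact ⟨_, _, .L3 q a b h, rfl, rfl⟩
  | L4 p q r s a b h => exact ⟨_, _, .L4 p q r s a b h, map_inf f _ _, map_sup f _ _⟩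
  | L4_gt p q r a b h => exact ⟨_, _, .L4_gt p q r a b h, map_inf f _ _, rfl⟩
  | L5 p q r s a b h => exact ⟨_, _, .L5 p q r s a b h, map_inf f _ _, map_sup f _ _⟩

end Presentation

/-! ### Measures as models of the laws -/

section Models

variable {D : Type*} [DistribLattice D] [BoundedOrder D]

/-- A truth assignment to the symbols `P_{≥p} a` is a model if it satisfies (L1)--(L5), read in the
two-element lattice `Prop`. -/
def IsModel (P : Set.Icc (0 : ℚ) 1 → D → Prop) : Prop := ∀ φ ψ, Law P φ ψ → φ ≤ ψ

theorem Mea.isModel (μ : Mea D) : IsModel fun p a => Gam.circ p ≤ μ.app a := by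
  obtain ⟨μ, hμ⟩ := μ
  change IsModel fun p a => Gam.circ p ≤ μ a
  intro φ ψ h
  cases h with
  | L1 p q a h => exact fun hq => (Gam.circ_le_circ.2 h).trans hq
  | L2_false p h =>
    intro hp
    rw [hμ.map_bot, Gam.circ_le_circ] at hp
    exact absurd h (not_lt.2 hp)
  | L2_zero p h =>
    intro _
    rw [hμ.map_bot, Gam.circ_le_circ]
    exact h.le
  | L2_true q =>
    intro _
    rw [hμ.map_top, Gam.circ_le_circ]
    exact q.2.2
  | L3 q a b h => exact fun hq => hq.trans (hμ.mono h)
  | L4 p q r s a b h =>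
    rintro ⟨hp, hq⟩
    refine or_iff_not_imp_right.2 fun hr => ?_
    rcases le_total r p with hrp | hpr
    · obtain ⟨s', hs', hsu⟩ :=
        (Gam.miss_le_mip_iff _ _).1 (hμ.miss_le_mip a b) p r q hp hrp hr hq
      have : s = s' := Subtype.ext (by rw [h, hs']; ring)
      rwa [this]
    · -- here `p + q - r ≤ q`, so that `P_{≥q} b` already gives `P_{≥p+q-r} (a ⊔ b)`
      have hpr' : (p : ℚ) ≤ r := hpr
      exact (Gam.circ_le_circ.2 (by linarith)).trans (hq.trans (hμ.mono le_sup_right))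
  | L4_gt p q r a b h =>
    rintro ⟨hp, hq⟩
    by_contra hr
    have hq1 := q.2.2
    obtain ⟨s', hs', -⟩ := (Gam.miss_le_mip_iff _ _).1 (hμ.miss_le_mip a b) p r q hp
      (show (r : ℚ) ≤ p by linarith) hr hq
    have hs1 := s'.2.2
    linarith
  | L5 p q r s a b h =>
    rintro ⟨hs, hr⟩
    refine or_iff_not_imp_right.2 fun hq => ?_
    rcases le_total q s with hqs | hsq
    · obtain ⟨s', hs', hsu⟩ :=
        (Gam.miss_le_mip_iff _ _).1 (hμ.miss_le_mip' a b) s q r hs hqs hq hr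
      have : p = s' := Subtype.ext (by rw [hs', h]; ring)
      rwa [this]
    · have hsq' : (s : ℚ) ≤ q := hsq
      exact (Gam.circ_le_circ.2 (by linarith)).trans (hr.trans (hμ.mono inf_le_left))

namespace IsModel

variable {P : Set.Icc (0 : ℚ) 1 → D → Prop}

theorem circ_le_join_iff (h : IsModel P) {p : Set.Icc (0 : ℚ) 1} {a : D} :
    Gam.circ p ≤ Gam.join (Gam.circ '' {q | P q a}) ↔ P p a :=
  Gam.circ_le_join_iff (fun _ _ hpq hq => h _ _ (.L1 _ _ a hpq) hq)
    (h _ _ (.L3 _ ⊥ a bot_le) (h _ _ (.L2_zero _ rfl) trivial))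

/-- The function `a ↦ ⋁ {p° | P p a}` given by a model `P` is a measure. -/
theorem isMeasure (h : IsModel P) :
    IsMeasure fun a => Gam.join (Gam.circ '' {q | P q a}) where
  map_bot := by
    refine le_antisymm (Gam.le_of_forall_circ fun p hp => ?_) (Gam.circ_zero_le _)
    rw [h.circ_le_join_iff] at hp
    by_contra hlt
    rw [Gam.circ_le_circ, not_le] at hlt
    exact h _ _ (.L2_false p hlt) hp
  map_top := by
    refine le_antisymm (Gam.le_of_forall_circ fun p _ => Gam.circ_le_circ.2 p.2.2) ?_
    exact h.circ_le_join_iff.2 (h _ _ (.L2_true _) trivial)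
  mono a b hab := Gam.le_of_forall_circ fun p hp =>
    h.circ_le_join_iff.2 (h _ _ (.L3 p a b hab) (h.circ_le_join_iff.1 hp))
  miss_le_mip a b := by
    rw [Gam.miss_le_mip_iff]
    simp only [h.circ_le_join_iff]
    intro p q t hp hqp hq ht
    have hqp' : (q : ℚ) ≤ p := hqp
    have ht0 := t.2.1
    rcases le_or_gt ((p : ℚ) - q + t) 1 with h1 | h1
    · refine ⟨⟨p - q + t, by linarith, h1⟩, rfl, ?_⟩
      exact (h _ _ (.L4 p t q _ a b (by simp only; ring)) ⟨hp, ht⟩).resolve_right hq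
    · exact absurd (h _ _ (.L4_gt p t q a b (by linarith)) ⟨hp, ht⟩) hq
  miss_le_mip' a b := by
    rw [Gam.miss_le_mip_iff]
    simp only [h.circ_le_join_iff]
    intro p q t hp hqp hq ht
    have hqp' : (q : ℚ) ≤ p := hqp
    have ht0 := t.2.1
    have hp1 := p.2.2
    -- `t < q` since `P t b` holds but `P q b` does not; hence `p - q + t ≤ 1`, and (L5) applies
    have htq : (t : ℚ) < q := by
      by_contra! hle
      exact hq (h _ _ (.L1 q t b hle) (h _ _ (.L3 t _ b inf_le_right) ht))
    refine ⟨⟨p - q + t, by linarith, by linarith⟩, rfl, ?_⟩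
    exact (h _ _ (.L5 _ q t p a b (by simp only; ring)) ⟨hp, ht⟩).resolve_right hq

/-- The measure `a ↦ ⋁ {p° | P p a}` of a model `P`. -/
noncomputable def toMea (h : IsModel P) : Mea D := ⟨_, h.isMeasure⟩

theorem circ_le_toMea_app (h : IsModel P) {p : Set.Icc (0 : ℚ) 1} {a : D} :
    Gam.circ p ≤ h.toMea.app a ↔ P p a :=
  h.circ_le_join_iff

end IsModel

namespace Mea

theorem le_iff {μ ν : Mea D} :
    μ ≤ ν ↔ ∀ p a, Gam.circ p ≤ μ.app a → Gam.circ p ≤ ν.app a :=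
  ⟨fun h _ a hp => hp.trans (h a), fun h a => Gam.le_of_forall_circ fun p => h p a⟩

/-- The truth values of the symbols `P_{≥p} a` at a measure. -/
def geVal (μ : Mea D) : GeVar D → Prop
  | .ge p a => Gam.circ p ≤ μ.app a

/-- The truth values of the symbols `P_{≥p} a` and `P_{<p} a` at a measure. -/
def geLtVal (μ : Mea D) : GeLtVar D → Prop
  | .ge p a => Gam.circ p ≤ μ.app a
  | .lt p a => μ.app a < Gam.circ p

/-- The truth values of the elements of `P(D)` at a measure, with `P_{≥p} a` read as
`μ(a) ≥ p°`. -/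
def eval (μ : Mea D) : BoundedLatticeHom (PLat D) Prop :=
  LatQuot.lift (FreeDL.lift μ.geVal) fun _ _ h => μ.isModel _ _ (h.map (FreeDL.lift μ.geVal))

theorem eval_ge (μ : Mea D) (p : Set.Icc (0 : ℚ) 1) (a : D) :
    μ.eval (PLat.ge p a) = (Gam.circ p ≤ μ.app a) := rfl

/-- The truth values at a measure of the elements of the quotient by (L1)--(L6), with `P_{≥p} a`
read as `μ(a) ≥ p°` and `P_{<p} a` as `μ(a) < p°`. -/
def boolEval (μ : Mea D) : BoundedLatticeHom (BLat D) Prop :=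
  LatQuot.lift (FreeDL.lift μ.geLtVal) fun φ ψ h => by
    cases h with
    | L1_to_L5 h => exact μ.isModel _ _ (h.map (FreeDL.lift μ.geLtVal))
    | L6_contra q a => exact fun h => absurd h.1 (not_lt.2 h.2)
    | L6_em q a => exact fun _ => lt_or_ge (μ.app a) (Gam.circ q)

theorem isModel_of_hom (f : BoundedLatticeHom (PLat D) Prop) :
    IsModel fun p (a : D) => f (PLat.ge p a) := by
  intro φ ψ h
  obtain ⟨φ, ψ, hR, rfl, rfl⟩ := Law.exists_of_map (f.comp (LatQuot.mkHom (pCon D))) h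
  exact OrderHomClass.mono f (LatQuot.mk_le_mk hR)

/-- The measure whose truth values are given by a homomorphism `P(D) → Prop`. -/
noncomputable def ofHom (f : BoundedLatticeHom (PLat D) Prop) : Mea D := (isModel_of_hom f).toMea

theorem eval_ofHom (f : BoundedLatticeHom (PLat D) Prop) : (ofHom f).eval = f :=
  LatQuot.hom_ext fun ⟨_, _⟩ => propext (isModel_of_hom f).circ_le_toMea_app

theorem eval_injective : Function.Injective (eval : Mea D → _) := fun μ ν h =>
  le_antisymm (le_iff.2 fun p a hp => by rwa [← eval_ge, ← h])
    (le_iff.2 fun p a hp => by rwa [← eval_ge, h])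

theorem exists_boolEval_eq (f : BoundedLatticeHom (BLat D) Prop) :
    ∃ μ : Mea D, μ.boolEval = f := by
  have hP : IsModel fun p (a : D) => f (BLat.ge p a) := by
    intro φ ψ h
    obtain ⟨φ, ψ, hR, rfl, rfl⟩ := Law.exists_of_map (f.comp (LatQuot.mkHom (bCon D))) h
    exact OrderHomClass.mono f (LatQuot.mk_le_mk (.L1_to_L5 hR))
  refine ⟨hP.toMea, LatQuot.hom_ext ?_⟩
  rintro (⟨p, a⟩ | ⟨p, a⟩)
  · exact propext hP.circ_le_toMea_app
  · -- by (L6), `P_{<p} a` has the truth value opposite to that of `P_{≥p} a`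
    have hc : f (BLat.lt p a) → ¬ f (BLat.ge p a) := by
      have h : f (BLat.lt p a ⊓ BLat.ge p a) ≤ f ⊥ :=
        OrderHomClass.mono f (LatQuot.mk_le_mk (.L6_contra p a))
      rw [LatQuot.hom_inf, map_bot] at h
      exact fun h1 h2 => h ⟨h1, h2⟩
    have he : f (BLat.lt p a) ∨ f (BLat.ge p a) := by
      have h : f ⊤ ≤ f (BLat.lt p a ⊔ BLat.ge p a) :=
        OrderHomClass.mono f (LatQuot.mk_le_mk (.L6_em p a))
      rw [LatQuot.hom_sup, map_top] at h
      exact h trivial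
    have hlt : f (BLat.lt p a) ↔ ¬ f (BLat.ge p a) := ⟨hc, he.resolve_right⟩
    refine propext (Iff.trans ?_ hlt.symm)
    change hP.toMea.app a < Gam.circ p ↔ _
    rw [← not_le, hP.circ_le_toMea_app]

end Mea

end Models

/-! ### Prime filters as homomorphisms to `Prop` -/

theorem DualSpace.isClopen_mem {L : Type*} [DistribLattice L] (φ : L) :
    IsClopen {F : DualSpace L | φ ∈ F.1} :=
  ⟨isOpen_compl_iff.1 (TopologicalSpace.isOpen_generateFrom_of_mem (Or.inr ⟨φ, rfl⟩)),
    TopologicalSpace.isOpen_generateFrom_of_mem (Or.inl ⟨φ, rfl⟩)⟩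

section PrimeFilters

variable {L : Type*} [DistribLattice L] [BoundedOrder L]

/-- The characteristic function of a prime filter. -/
def DualSpace.toHom (F : DualSpace L) : BoundedLatticeHom L Prop where
  toFun φ := φ ∈ F.1
  map_sup' φ ψ := by
    have hI := F.2.compl_ideal
    refine propext ⟨fun h => ?_, fun h => h.elim (Order.PFilter.mem_of_le le_sup_left)
      (Order.PFilter.mem_of_le le_sup_right)⟩
    by_contra hn
    replace hn := not_or.1 hn
    obtain ⟨χ, hχ, h1, h2⟩ := hI.Directed φ hn.1 ψ hn.2
    exact hχ (Order.PFilter.mem_of_le (sup_le h1 h2) h)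
  map_inf' φ ψ := propext Order.PFilter.inf_mem_iff
  map_top' := eq_true Order.PFilter.top_mem
  map_bot' := by
    obtain ⟨χ, hχ⟩ := F.2.compl_ideal.Nonempty
    exact eq_false fun h => hχ (Order.PFilter.mem_of_le bot_le h)

/-- The prime filter of the elements that a homomorphism sends to `True`. -/
def DualSpace.ofHom (f : BoundedLatticeHom L Prop) : DualSpace L :=
  ⟨Order.IsPFilter.toPFilter (F := {φ | f φ}) (.of_def ⟨⊤, by simp⟩
      (fun φ hφ ψ hψ => ⟨φ ⊓ ψ, by
        simp only [Set.mem_ofPred_eq] at *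
        rw [map_inf]; exact ⟨hφ, hψ⟩, inf_le_left, inf_le_right⟩)
      fun h hφ => OrderHomClass.mono f h hφ),
    ⟨⟨fun _ _ h hφ hψ => hφ (OrderHomClass.mono f h hψ),
      ⟨⊥, by
        change ¬ f ⊥
        simp⟩,
      fun φ hφ ψ hψ => ⟨φ ⊔ ψ, by
        change ¬ f (φ ⊔ ψ)
        rw [map_sup]; exact not_or.2 ⟨hφ, hψ⟩, le_sup_left, le_sup_right⟩⟩⟩⟩

theorem DualSpace.mem_ofHom (f : BoundedLatticeHom L Prop) (φ : L) :
    φ ∈ (DualSpace.ofHom f).1 ↔ f φ := Iff.rfl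

/-- The prime filter theorem: homomorphisms to `Prop` detect the order. -/
theorem le_of_forall_hom {φ ψ : L} (h : ∀ f : BoundedLatticeHom L Prop, f φ → f ψ) : φ ≤ ψ := by
  by_contra hle
  have hd : Disjoint (Order.PFilter.principal φ : Set L) (Order.Ideal.principal ψ : Set L) :=
    Set.disjoint_left.2 fun χ (h1 : φ ≤ χ) (h2 : χ ≤ ψ) => hle (h1.trans h2)
  obtain ⟨J, hJ, hψ, hφ⟩ := DistribLattice.prime_ideal_of_disjoint_filter_ideal hd
  let F : DualSpace L := ⟨hJ.toPrimePair.F, hJ.toPrimePair.F_isPrime⟩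
  have hF : ∀ χ, F.toHom χ ↔ χ ∉ J := fun χ =>
    (Set.ext_iff.1 hJ.toPrimePair.compl_I_eq_F χ).symm
  exact (hF ψ).1 (h F.toHom ((hF φ).2 (Set.disjoint_left.1 hφ (le_refl φ)))) (hψ (le_refl ψ))

/-- An ultrafilter of prime filters converges to the prime filter of the elements that belong to
almost all of them. -/
instance : CompactSpace (DualSpace L) := by
  refine ⟨isCompact_iff_ultrafilter_le_nhds.2 fun U _ => ?_⟩
  let f : BoundedLatticeHom L Prop :=
    { toFun φ := ∀ᶠ F in (U : Filter (DualSpace L)), F.toHom φ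
      map_sup' φ ψ := by
        simp only [map_sup, sup_Prop_eq]
        exact propext Ultrafilter.eventually_or
      map_inf' φ ψ := by
        simp only [map_inf, inf_Prop_eq]
        exact propext Filter.eventually_and
      map_top' := by simp
      map_bot' := by simp [U.neBot.ne] }
  refine ⟨DualSpace.ofHom f, trivial, ?_⟩
  rw [TopologicalSpace.nhds_generateFrom]
  refine le_iInf₂ fun s hs => Filter.le_principal_iff.2 ?_
  obtain ⟨hF, ⟨φ, rfl⟩ | ⟨φ, rfl⟩⟩ := hs
  · exact hF
  · exact Ultrafilter.compl_mem_iff_notMem.2 hF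

end PrimeFilters

/-! ### Clopen sets separated by a lattice of clopen sets -/

/-- If the elements of a lattice `L` define clopen sets of a compact space, then each clopen set
whose points can be told apart from the points of its complement by elements of `L` is itself
defined by an element of `L`. -/
theorem exists_eq_of_separated {X L : Type*} [TopologicalSpace X] [CompactSpace X]
    [DistribLattice L] [BoundedOrder L] (ev : X → BoundedLatticeHom L Prop)
    (hev : ∀ φ, IsClopen {x | ev x φ}) {U : Set X} (hU : IsClopen U)
    (hsep : ∀ x ∈ U, ∀ y ∉ U, ∃ φ, ev x φ ∧ ¬ ev y φ) : ∃ φ, {x | ev x φ} = U := by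
  have hx : ∀ x ∈ U, ∃ φ, ev x φ ∧ ∀ y ∈ Uᶜ, ¬ ev y φ := by
    intro x hxU
    refine hU.compl.1.isCompact.induction_on (p := fun s => ∃ φ, ev x φ ∧ ∀ y ∈ s, ¬ ev y φ)
      ⟨⊤, by simp, by simp⟩ (fun s t hst ⟨φ, h, h'⟩ => ⟨φ, h, fun y hy => h' y (hst hy)⟩) ?_ ?_
    · rintro s t ⟨φ, hφ, hs⟩ ⟨ψ, hψ, ht⟩
      refine ⟨φ ⊓ ψ, by rw [map_inf]; exact ⟨hφ, hψ⟩, fun y hy h => ?_⟩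
      rw [map_inf] at h
      exact hy.elim (fun hy => hs y hy h.1) fun hy => ht y hy h.2
    · intro y hy
      obtain ⟨φ, hφ, hn⟩ := hsep x hxU y hy
      exact ⟨_, mem_nhdsWithin_of_mem_nhds ((hev φ).compl.2.mem_nhds hn), φ, hφ, fun _ h => h⟩
  obtain ⟨φ, h1, h2⟩ : ∃ φ, (∀ x ∈ U, ev x φ) ∧ ∀ y ∈ Uᶜ, ¬ ev y φ := by
    refine hU.1.isCompact.induction_on
      (p := fun s => ∃ φ, (∀ x ∈ s, ev x φ) ∧ ∀ y ∈ Uᶜ, ¬ ev y φ)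
      ⟨⊥, by simp, by simp⟩ (fun s t hst ⟨φ, h, h'⟩ => ⟨φ, fun y hy => h y (hst hy), h'⟩) ?_ ?_
    · rintro s t ⟨φ, hs, hφ⟩ ⟨ψ, ht, hψ⟩
      refine ⟨φ ⊔ ψ, fun x hx => ?_, fun y hy h => ?_⟩
      · rw [map_sup]; exact hx.imp (hs x) (ht x)
      · rw [map_sup] at h
        exact h.elim (hφ y hy) (hψ y hy)
    · intro x hxU
      obtain ⟨φ, hφ, hn⟩ := hx x hxU
      exact ⟨_, mem_nhdsWithin_of_mem_nhds ((hev φ).2.mem_nhds hφ), φ, fun _ h => h, hn⟩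
  exact ⟨φ, Set.ext fun x => ⟨fun h => by_contra fun hn => h2 x hn h, h1 x⟩⟩

/-! ### The space of measures -/

section MeasureSpace

variable {D : Type*} [DistribLattice D] [BoundedOrder D]

namespace Mea

theorem isClopen_circ_le (p : Set.Icc (0 : ℚ) 1) (a : D) :
    IsClopen {μ : Mea D | Gam.circ p ≤ μ.app a} :=
  (Gam.isClopen_Ici_circ p).preimage
    (show Continuous fun μ : Mea D => μ.1 a from (continuous_apply a).comp continuous_subtype_val)

theorem isClopen_eval (φ : PLat D) : IsClopen {μ : Mea D | μ.eval φ} := by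
  induction φ using LatQuot.induction with
  | of v => obtain ⟨p, a⟩ := v; exact isClopen_circ_le p a
  | bot => simp [isClopen_empty]
  | top => simp [isClopen_univ]
  | inf φ ψ hφ hψ => simp only [LatQuot.hom_inf]; exact hφ.inter hψ
  | sup φ ψ hφ hψ => simp only [LatQuot.hom_sup]; exact hφ.union hψ

theorem isClopen_boolEval (φ : BLat D) : IsClopen {μ : Mea D | μ.boolEval φ} := by
  induction φ using LatQuot.induction with
  | of v =>
    obtain ⟨p, a⟩ | ⟨p, a⟩ := v
    · exact isClopen_circ_le p a
    · have : {μ : Mea D | μ.app a < Gam.circ p} = {μ | Gam.circ p ≤ μ.app a}ᶜ := by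
        ext μ; exact (not_le (a := Gam.circ p) (b := μ.app a)).symm
      change IsClopen {μ : Mea D | μ.app a < Gam.circ p}
      rw [this]; exact (isClopen_circ_le p a).compl
  | bot => simp [isClopen_empty]
  | top => simp [isClopen_univ]
  | inf φ ψ hφ hψ => simp only [LatQuot.hom_inf]; exact hφ.inter hψ
  | sup φ ψ hφ hψ => simp only [LatQuot.hom_sup]; exact hφ.union hψ

theorem isUpperSet_eval (φ : PLat D) : IsUpperSet {μ : Mea D | μ.eval φ} := by
  induction φ using LatQuot.induction with
  | of v => obtain ⟨p, a⟩ := v; exact fun μ ν h hμ => le_iff.1 h p a hμ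
  | bot => simp [isUpperSet_empty]
  | top => simp [isUpperSet_univ]
  | inf φ ψ hφ hψ => simp only [LatQuot.hom_inf]; exact hφ.inter hψ
  | sup φ ψ hφ hψ => simp only [LatQuot.hom_sup]; exact hφ.union hψ

theorem le_iff_eval {μ ν : Mea D} : μ ≤ ν ↔ ∀ φ, μ.eval φ → ν.eval φ :=
  ⟨fun h φ => isUpperSet_eval φ h, fun h => le_iff.2 fun p a => h (PLat.ge p a)⟩

variable (D) in
/-- Prime filters of `P(D)` correspond to measures: `φ` belongs to a prime filter if and only if it
is true at the corresponding measure. -/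
noncomputable def dualHomeo : DualSpace (PLat D) ≃ₜ Mea D where
  toFun F := ofHom F.toHom
  invFun μ := DualSpace.ofHom μ.eval
  left_inv F := Subtype.ext (SetLike.ext fun φ => by
    rw [DualSpace.mem_ofHom, eval_ofHom]; rfl)
  right_inv μ := eval_injective (by rw [eval_ofHom]; rfl)
  continuous_toFun := by
    refine Continuous.subtype_mk (continuous_pi fun a => Gam.continuous_of_isClopen fun p => ?_) _
    convert DualSpace.isClopen_mem (PLat.ge p a) using 1
    ext F
    exact (isModel_of_hom F.toHom).circ_le_toMea_app
  continuous_invFun := by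
    refine continuous_generateFrom_iff.2 ?_
    rintro _ (⟨φ, rfl⟩ | ⟨φ, rfl⟩)
    · exact (isClopen_eval φ).2
    · exact (isClopen_eval φ).compl.2

theorem eval_dualHomeo (F : DualSpace (PLat D)) (φ : PLat D) :
    (dualHomeo D F).eval φ ↔ φ ∈ F.1 := by
  change (ofHom F.toHom).eval φ ↔ _
  rw [eval_ofHom]; rfl

instance : CompactSpace (Mea D) := (dualHomeo D).compactSpace

instance : PriestleySpace (Mea D) where
  priestley {μ ν} h := by
    simp only [le_iff_eval, not_forall] at h
    obtain ⟨φ, hμ, hν⟩ := h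
    exact ⟨_, isClopen_eval φ, isUpperSet_eval φ, hμ, hν⟩

variable (D) in
/-- `P(D)` is the lattice of clopen up-sets of the space of measures. -/
noncomputable def evalIso : PLat D ≃o ClopenUpperSet (Mea D) :=
  RelIso.ofSurjective
    (OrderEmbedding.ofMapLEIff
      (fun φ => (⟨⟨{μ | μ.eval φ}, isClopen_eval φ⟩, isUpperSet_eval φ⟩ : ClopenUpperSet (Mea D)))
      fun φ ψ => ⟨fun h => le_of_forall_hom fun f => by
          rw [← eval_ofHom f]; exact @h (ofHom f),
        fun h μ hμ => OrderHomClass.mono μ.eval h hμ⟩)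
    fun U => by
      obtain ⟨φ, hφ⟩ := exists_eq_of_separated eval isClopen_eval U.isClopen
        fun μ hμ ν hν => by
          have h : ¬ μ ≤ ν := fun h => hν (U.upper h hμ)
          simpa only [le_iff_eval, not_forall, exists_prop] using h
      exact ⟨φ, SetLike.coe_injective hφ⟩

variable (D) in
/-- The quotient by (L1)--(L6) is the lattice of clopen sets of the space of measures. -/
noncomputable def boolEvalIso : BLat D ≃o TopologicalSpace.Clopens (Mea D) :=
  RelIso.ofSurjective
    (OrderEmbedding.ofMapLEIff
      (fun φ => (⟨{μ | μ.boolEval φ}, isClopen_boolEval φ⟩ : TopologicalSpace.Clopens (Mea D)))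
      fun φ ψ => ⟨fun h => le_of_forall_hom fun f => by
          obtain ⟨μ, rfl⟩ := exists_boolEval_eq f
          exact @h μ,
        fun h μ hμ => OrderHomClass.mono μ.boolEval h hμ⟩)
    fun U => by
      obtain ⟨φ, hφ⟩ := exists_eq_of_separated boolEval isClopen_boolEval U.isClopen
        fun μ hμ ν hν => by
          have hne : μ ≠ ν := fun h => hν (h ▸ hμ)
          rcases hne.not_le_or_not_ge with h | h <;>
            simp only [le_iff, not_forall, exists_prop] at h <;>
            obtain ⟨p, a, h1, h2⟩ := h
          · exact ⟨BLat.ge p a, h1, h2⟩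
          · exact ⟨BLat.lt p a, not_le.1 h2, not_lt.2 h1⟩
      exact ⟨φ, SetLike.coe_injective hφ⟩

end Mea

end MeasureSpace

end ProbLogic

theorem theoremt (D : Type*) [DistribLattice D] [BoundedOrder D] :
    -- `Mea D` is a Priestley space
    CompactSpace (ProbLogic.Mea D) ∧ PriestleySpace (ProbLogic.Mea D) ∧
    -- `P(D)` is isomorphic to the dual lattice (clopen up-sets) of `Mea D`
    (∃ e : ProbLogic.PLat D ≃o ClopenUpperSet (ProbLogic.Mea D),
      (∀ (p : Set.Icc (0 : ℚ) 1) (a : D),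
        (e (ProbLogic.PLat.ge p a) : Set (ProbLogic.Mea D)) =
          {μ | ProbLogic.Gam.circ p ≤ μ.app a}) ∧
      -- the measures are exactly the types of the logic, as ordered topological spaces
      ∃ θ : ProbLogic.DualSpace (ProbLogic.PLat D) ≃ₜ ProbLogic.Mea D,
        (∀ F G, θ F ≤ θ G ↔ F ≤ G) ∧
        ∀ (F : ProbLogic.DualSpace (ProbLogic.PLat D)) (φ : ProbLogic.PLat D),
          φ ∈ F.1 ↔ θ F ∈ e φ) ∧
    -- with (L6): the Boolean algebra of all clopens of `Mea D`
    ∃ e' : ProbLogic.BLat D ≃o TopologicalSpace.Clopens (ProbLogic.Mea D),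
      ∀ (p : Set.Icc (0 : ℚ) 1) (a : D),
        (e' (ProbLogic.BLat.ge p a) : Set (ProbLogic.Mea D)) =
          {μ | ProbLogic.Gam.circ p ≤ μ.app a} ∧
        (e' (ProbLogic.BLat.lt p a) : Set (ProbLogic.Mea D)) =
          {μ | μ.app a < ProbLogic.Gam.circ p} := by
  refine ⟨inferInstance, inferInstance,
    ⟨ProbLogic.Mea.evalIso D, fun _ _ => rfl, ProbLogic.Mea.dualHomeo D, fun F G => ?_,
      fun F φ => (ProbLogic.Mea.eval_dualHomeo F φ).symm⟩,
    ProbLogic.Mea.boolEvalIso D, fun _ _ => ⟨rfl, rfl⟩⟩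
  rw [ProbLogic.Mea.le_iff_eval]
  simp only [ProbLogic.Mea.eval_dualHomeo]
  rfl
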